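/- Let $\Gamma=(V,E)$ be an undirected graph (at most one edge between two vertices, no vertex connected to itself), and for every $v\in V$ let $P_v$ be a submonoid of a group $G_v$. Let $P=\Gamma_{v\in V}P_v$ be the monoid obtained from the free product of monoids $*_{v\in V}P_v$ by introducing the relations $xy=yx$ for all $x\in P_v$, $y\in P_w$ with $(v,w)\in E$, and let $G=\Gamma_{v\in V}G_v$ be the group obtained from the free product $*_{v\in V}G_v$ by introducing the relations $xy=yx$ for all $x\in G_v$, $y\in G_w$ with $(v,w)\in E$. For a left cancellative monoid $M$, let $I_l(M)$ (the left inverse hull) be the smallest set of partial bijections of $M$ that contains all maps $M\to pM$, $x\mapsto px$ ($p\in M$) and is closed under composition (on the largest possible domain) and inverses. A submonoid $Q$ of a group $H$ is called Toeplitz (written: $Q\subseteq H$ is Toeplitz) if for every $g\in H$ with $g^{-1}Q\cap Q\neq\emptyset$, the partial bijection $$g^{-1}Q\cap Q\to Q\cap gQ,\qquad x\mapsto gx$$ lies in $I_l(Q)$. If $P_v\subseteq G_v$ is Toeplitz for every $v\in V$, then the canonical homomorphism $P\to G$ induced by the inclusions $P_v\subseteq G_v$ is injective, and, identifying $P$ with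 its image in $G$, $P\subseteq G$ is Toeplitz. -/

import Mathlib

open scoped Pointwise

universe u v w

namespace GraphProduct

/-- The commutation relations of a graph product, on the free product of the vertex monoids:
`x y = y x` for `x ∈ M v`, `y ∈ M w` whenever `v` and `w` are joined by an edge. -/
inductive Rel {V : Type u} (Γ : SimpleGraph V) (M : V → Type v) [∀ v, Monoid (M v)] :
    Monoid.CoprodI M → Monoid.CoprodI M → Prop
  | comm {v w : V} (h : Γ.Adj v w) (x : M v) (y : M w) :
    Rel Γ M (Monoid.CoprodI.of x * Monoid.CoprodI.of y)
      (Monoid.CoprodI.of y * Monoid.CoprodI.of x)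

end GraphProduct

/-- The graph product of the monoids `M v` over the simple graph `Γ`: the quotient of the free
product by the congruence generated by the commutation relations. -/
def GraphProduct {V : Type u} (Γ : SimpleGraph V) (M : V → Type v) [∀ v, Monoid (M v)] :
    Type (max u v) :=
  (conGen (GraphProduct.Rel Γ M)).Quotient

namespace GraphProduct

instance instMonoid {V : Type u} (Γ : SimpleGraph V) (M : V → Type v) [∀ v, Monoid (M v)] :
    Monoid (GraphProduct Γ M) :=
  inferInstanceAs (Monoid (conGen (GraphProduct.Rel Γ M)).Quotient)

instance instGroup {V : Type u} (Γ : SimpleGraph V) (G : V → Type v) [∀ v, Group (G v)] :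
    Group (GraphProduct Γ G) :=
  inferInstanceAs (Group (conGen (GraphProduct.Rel Γ G)).Quotient)

/-- The canonical homomorphism from the free product onto the graph product. -/
def mk {V : Type u} (Γ : SimpleGraph V) (M : V → Type v) [∀ v, Monoid (M v)] :
    Monoid.CoprodI M →* GraphProduct Γ M :=
  (conGen (GraphProduct.Rel Γ M)).mk'

/-- The canonical homomorphism from a vertex monoid to the graph product. -/
def of {V : Type u} (Γ : SimpleGraph V) {M : V → Type v} [∀ v, Monoid (M v)] (v : V) :
    M v →* GraphProduct Γ M :=
  (mk Γ M).comp Monoid.CoprodI.of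

theorem of_comm {V : Type u} (Γ : SimpleGraph V) {M : V → Type v} [∀ v, Monoid (M v)]
    {v w : V} (h : Γ.Adj v w) (x : M v) (y : M w) :
    of Γ v x * of Γ w y = of Γ w y * of Γ v x :=
  (Con.eq _).mpr (ConGen.Rel.of _ _ (Rel.comm h x y))

/-- The universal property of the graph product. -/
def lift {V : Type u} (Γ : SimpleGraph V) {M : V → Type v} [∀ v, Monoid (M v)]
    {N : Type w} [Monoid N] (f : ∀ v, M v →* N)
    (hf : ∀ {v w : V}, Γ.Adj v w → ∀ (x : M v) (y : M w), f v x * f w y = f w y * f v x) :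
    GraphProduct Γ M →* N :=
  (conGen (GraphProduct.Rel Γ M)).lift (Monoid.CoprodI.lift f) <| Con.conGen_le.2 <| by
    rintro _ _ ⟨h, x, y⟩
    simpa [Con.ker_rel] using hf h x y

theorem lift_of {V : Type u} (Γ : SimpleGraph V) {M : V → Type v} [∀ v, Monoid (M v)]
    {N : Type w} [Monoid N] (f : ∀ v, M v →* N)
    (hf : ∀ {v w : V}, Γ.Adj v w → ∀ (x : M v) (y : M w), f v x * f w y = f w y * f v x)
    (v : V) (x : M v) : lift Γ f hf (of Γ v x) = f v x :=
  Monoid.CoprodI.lift_of f x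

/-- The canonical homomorphism `Γ P_v → Γ G_v` induced by the inclusions `P_v ⊆ G_v`. -/
def inclusion {V : Type u} (Γ : SimpleGraph V) {G : V → Type v} [∀ v, Group (G v)]
    (P : ∀ v, Submonoid (G v)) : GraphProduct Γ (fun v => P v) →* GraphProduct Γ G :=
  lift Γ (fun v => (of Γ v).comp (P v).subtype) fun h x y => of_comm Γ h (x : G _) (y : G _)

theorem inclusion_of {V : Type u} (Γ : SimpleGraph V) {G : V → Type v} [∀ v, Group (G v)]
    (P : ∀ v, Submonoid (G v)) (v : V) (x : P v) :
    inclusion Γ P (of Γ v x) = of Γ v (x : G v) :=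
  lift_of Γ (M := fun v => P v) (fun v => (of Γ v).comp (P v).subtype)
    (fun h x y => of_comm Γ h (x : G _) (y : G _)) v x

end GraphProduct

open Classical in
/-- The partial bijection `M → pM, x ↦ p x` of a left cancellative semigroup `M`. -/
noncomputable def leftMulPEquiv {M : Type u} [Mul M] [IsLeftCancelMul M] (p : M) : M ≃. M where
  toFun x := some (p * x)
  invFun y := if h : ∃ x, p * x = y then some h.choose else none
  inv x y := by
    by_cases h : ∃ x, p * x = y
    · rw [dif_pos h, Option.some.injEq, Option.some.injEq]
      constructor
      · rintro rfl
        exact h.choose_spec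
      · intro hx
        exact mul_left_cancel (h.choose_spec.trans hx.symm)
    · rw [dif_neg h]
      simp only [Option.some.injEq, reduceCtorEq, false_iff]
      exact fun hx => h ⟨x, hx⟩

/-- The left inverse hull `I_l(M)` of a left cancellative semigroup `M`: the smallest set of
partial bijections of `M` which contains all left multiplications and is closed under
composition and inverses. -/
inductive LeftInverseHull (M : Type u) [Mul M] [IsLeftCancelMul M] : Set (M ≃. M)
  | leftMul (p : M) : LeftInverseHull M (leftMulPEquiv p)
  | symm {s : M ≃. M} : LeftInverseHull M s → LeftInverseHull M s.symm
  | comp {s t : M ≃. M} :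
    LeftInverseHull M s → LeftInverseHull M t → LeftInverseHull M (t.trans s)

open Classical in
/-- The partial bijection `g⁻¹P ∩ P → P ∩ gP, x ↦ g x` of `P`. -/
noncomputable def Submonoid.translationPEquiv {G : Type u} [Group G] (P : Submonoid G) (g : G) :
    P ≃. P where
  toFun x := if h : g * (x : G) ∈ P then some ⟨g * (x : G), h⟩ else none
  invFun y := if h : g⁻¹ * (y : G) ∈ P then some ⟨g⁻¹ * (y : G), h⟩ else none
  inv x y := by
    obtain ⟨x, hx⟩ := x
    obtain ⟨y, hy⟩ := y
    simp only [Option.dite_none_right_eq_some, Option.some.injEq, Subtype.mk.injEq]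
    constructor
    · rintro ⟨_, rfl⟩
      simpa using hy
    · rintro ⟨_, rfl⟩
      simpa using hx

/-- The Toeplitz condition for a submonoid `P` of a group `G`. -/
def Submonoid.IsToeplitz {G : Type u} [Group G] (P : Submonoid G) : Prop :=
  ∀ g : G, ((g⁻¹ • (P : Set G)) ∩ (P : Set G)).Nonempty →
    P.translationPEquiv g ∈ LeftInverseHull P

/-!
The proof rests on normal forms for graph products of monoids. Words in the vertex monoids are
studied through their projections: a vertex `v` sees the letters at `v`, does not see the letters at
neighbours of `v`, and sees every other letter as an anonymous marker. Two words with the same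
projections have the same product (`wordProd_eq_of_trace_eq`). A reduced word splits, uniquely up to
shuffling, into an initial part in `M v` and a rest without initial letter at `v`, so `M v` acts on
the projections of reduced words by left multiplication of the initial part. These actions assemble
to an action of the graph product, and evaluating it at the empty word shows that reduced words with
the same product have the same projections (`Reduced.trace_eq`). A reduced word in the `P v` remains
reduced as a word in the `G v`, hence `P → G` is injective, and an element of `G` lies in `P` if and
only if all its syllables do (`Reduced.wordProd_mem_mrange_iff`).

For the Toeplitz condition let `g = g₁ ⋯ gₙ` be reduced. The point is that `x, g x ∈ P` implies
`gₙ x ∈ P` (`of_mul_mem_mrange`). Write `x = c y`, where `c ∈ P v` is the initial part of `x` at the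
vertex `v` of `gₙ`. If `gₙ c` were not in `P v`, it would be a nontrivial syllable which survives in
`g x = g₁ ⋯ gₙ₋₁ (gₙ c) y`: the letters of `g₁ ⋯ gₙ₋₁` either can be shuffled to the right past `gₙ c`,
or are blocked by it directly or through other letters (`Reduced.exists_blocked`), so `g x` would not
be in `P`. Therefore the translation by `g` is the composite of the translations by the `gᵢ`. As a set
`P` is the product of `P v` and the elements without initial letter at `v`, and along this
decomposition members of `I_l(P v)` extend to members of `I_l(P)` (`exists_extension`). So the
Toeplitz condition for `P v` yields the claim for the translation by a single syllable.
-/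

namespace GraphProduct

/-! ### Words and their projections -/

section Words

variable {V : Type u} (Γ : SimpleGraph V) {M : V → Type v}

open Classical in
/-- What the vertex `v` sees of a letter `x`, as a list with at most one entry: the letter itself
if it lives at `v`, nothing if it lives at a neighbour of `v`, and an anonymous marker `none`
otherwise. -/
noncomputable def shadow (v : V) (x : Σ v, M v) : List (Option (Σ v, M v)) :=
  if x.1 = v then [some x] else if Γ.Adj x.1 v then [] else [none]

/-- The projections of a word to all vertices. This is a complete invariant of words up to
exchanging consecutive letters that live at adjacent vertices. -/
noncomputable def trace (l : List (Σ v, M v)) (v : V) : List (Option (Σ v, M v)) :=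
  l.flatMap (shadow Γ v)

/-- No letter at `v` can be shuffled to the front of the word `l`. -/
def NoHead (v : V) (l : List (Σ v, M v)) : Prop :=
  ∀ x, (trace Γ l v).head? ≠ some (some x)

variable {Γ}

theorem shadow_self (x : Σ v, M v) : shadow Γ x.1 x = [some x] := by
  simp [shadow]

theorem shadow_of_adj {v : V} {x : Σ v, M v} (h : Γ.Adj x.1 v) : shadow Γ v x = [] := by
  simp [shadow, h, h.ne]

theorem shadow_of_not_adj {v : V} {x : Σ v, M v} (hne : x.1 ≠ v) (h : ¬ Γ.Adj x.1 v) :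
    shadow Γ v x = [none] := by
  simp [shadow, h, hne]

theorem shadow_append_comm {x y : Σ v, M v} (h : Γ.Adj x.1 y.1) (v : V) :
    shadow Γ v x ++ shadow Γ v y = shadow Γ v y ++ shadow Γ v x := by
  by_cases hx : x.1 = v
  · subst hx
    simp [shadow_of_adj h.symm]
  by_cases hy : y.1 = v
  · subst hy
    simp [shadow_of_adj h]
  unfold shadow
  split_ifs <;> rfl

@[simp] theorem trace_nil (v : V) : trace Γ ([] : List (Σ v, M v)) v = [] := rfl

@[simp] theorem trace_cons (x : Σ v, M v) (l : List (Σ v, M v)) (v : V) :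
    trace Γ (x :: l) v = shadow Γ v x ++ trace Γ l v := rfl

@[simp] theorem trace_append (l l' : List (Σ v, M v)) (v : V) :
    trace Γ (l ++ l') v = trace Γ l v ++ trace Γ l' v := by
  simp [trace]

theorem trace_eq_nil_of_adj {v : V} {l : List (Σ v, M v)} (h : ∀ y ∈ l, Γ.Adj y.1 v) :
    trace Γ l v = [] := by
  simp only [trace, List.flatMap_eq_nil_iff]
  exact fun y hy => shadow_of_adj (h y hy)

theorem adj_of_trace_eq_nil {v : V} {l : List (Σ v, M v)} (h : trace Γ l v = []) :
    ∀ y ∈ l, Γ.Adj y.1 v := by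
  intro y hy
  have h' := List.flatMap_eq_nil_iff.1 h y hy
  by_contra hadj
  unfold shadow at h'
  split_ifs at h'

theorem mem_of_some_mem_trace {v : V} {l : List (Σ v, M v)} {x : Σ v, M v}
    (h : some x ∈ trace Γ l v) : x ∈ l := by
  obtain ⟨y, hy, hxy⟩ := List.mem_flatMap.1 h
  unfold shadow at hxy
  split_ifs at hxy <;> simp_all

theorem some_mem_trace {l : List (Σ v, M v)} {x : Σ v, M v} (h : x ∈ l) :
    some x ∈ trace Γ l x.1 :=
  List.mem_flatMap.2 ⟨x, h, by simp [shadow_self]⟩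

/-- A letter can be moved to the front past letters at adjacent vertices. -/
theorem trace_append_cons {x : Σ v, M v} {s : List (Σ v, M v)} (t : List (Σ v, M v))
    (hs : ∀ y ∈ s, Γ.Adj y.1 x.1) (v : V) :
    trace Γ (s ++ x :: t) v = trace Γ (x :: (s ++ t)) v := by
  induction s with
  | nil => rfl
  | cons y s ih =>
    have ih := ih fun z hz => hs z (by simp [hz])
    rw [List.cons_append, trace_cons, ih, trace_cons, ← List.append_assoc,
      shadow_append_comm (hs y (by simp))]
    simp

/-- A word whose projection to `v` begins with the letter `x` can be shuffled so that it begins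
with `x`. -/
theorem exists_eq_append_of_trace_eq_cons {v : V} {l : List (Σ v, M v)} {x : Σ v, M v}
    {r : List (Option (Σ v, M v))} (h : trace Γ l v = some x :: r) :
    x.1 = v ∧ ∃ s t, l = s ++ x :: t ∧ ∀ y ∈ s, Γ.Adj y.1 v := by
  induction l with
  | nil => simp at h
  | cons y l ih =>
    rw [trace_cons] at h
    by_cases hy : y.1 = v
    · subst hy
      simp only [shadow_self, List.cons_append, List.nil_append, List.cons.injEq,
        Option.some.injEq] at h
      obtain ⟨rfl, -⟩ := h
      exact ⟨rfl, [], l, rfl, by simp⟩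
    by_cases hadj : Γ.Adj y.1 v
    · rw [shadow_of_adj hadj] at h
      obtain ⟨hx, s, t, rfl, hs⟩ := ih h
      refine ⟨hx, y :: s, t, rfl, ?_⟩
      simpa [hadj] using hs
    · simp [shadow_of_not_adj hy hadj] at h

theorem noHead_congr {v : V} {l l' : List (Σ v, M v)} (h : trace Γ l v = trace Γ l' v) :
    NoHead Γ v l ↔ NoHead Γ v l' := by
  rw [NoHead, NoHead, h]

theorem noHead_of_append {v : V} {l l' : List (Σ v, M v)} (h : NoHead Γ v (l ++ l')) :
    NoHead Γ v l := by
  intro x hx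
  apply h x
  rw [trace_append, List.head?_append, hx]
  rfl

/-- Whether `v` sees a letter at the front is decided by the first entry of the projection. -/
theorem noHead_append_iff {v : V} {l l' l'' : List (Σ v, M v)} (h : trace Γ l v ≠ []) :
    NoHead Γ v (l ++ l') ↔ NoHead Γ v (l ++ l'') := by
  obtain ⟨a, r, har⟩ := List.exists_cons_of_ne_nil h
  simp [NoHead, har]

end Words

section Monoids

variable {V : Type u} (Γ : SimpleGraph V) {M : V → Type v} [∀ v, Monoid (M v)]

/-- The product in the graph product of a word in the vertex monoids. -/
def wordProd (l : List (Σ v, M v)) : GraphProduct Γ M :=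
  (l.map fun x => of Γ x.1 x.2).prod

@[simp] theorem wordProd_nil : wordProd Γ ([] : List (Σ v, M v)) = 1 := rfl

@[simp] theorem wordProd_cons (x : Σ v, M v) (l : List (Σ v, M v)) :
    wordProd Γ (x :: l) = of Γ x.1 x.2 * wordProd Γ l := by
  simp [wordProd]

@[simp] theorem wordProd_append (l l' : List (Σ v, M v)) :
    wordProd Γ (l ++ l') = wordProd Γ l * wordProd Γ l' := by
  simp [wordProd]

theorem wordProd_append_cons {x : Σ v, M v} {s : List (Σ v, M v)} (t : List (Σ v, M v))
    (hs : ∀ y ∈ s, Γ.Adj y.1 x.1) :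
    wordProd Γ (s ++ x :: t) = of Γ x.1 x.2 * wordProd Γ (s ++ t) := by
  induction s with
  | nil => simp
  | cons y s ih =>
    rw [List.cons_append, wordProd_cons, ih fun z hz => hs z (by simp [hz]), List.cons_append,
      wordProd_cons, ← mul_assoc, of_comm Γ (hs y (by simp)), mul_assoc]

/-- The product of a word depends only on the projections of the word. -/
theorem wordProd_eq_of_trace_eq {l l' : List (Σ v, M v)} (h : trace Γ l = trace Γ l') :
    wordProd Γ l = wordProd Γ l' := by
  induction l generalizing l' with
  | nil =>
    cases l' with
    | nil => rfl
    | cons y l' => simpa [shadow_self] using congr_fun h y.1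
  | cons x l ih =>
    have hx : trace Γ l' x.1 = some x :: trace Γ l x.1 := by
      rw [← h, trace_cons, shadow_self]; rfl
    obtain ⟨-, s, t, rfl, hs⟩ := exists_eq_append_of_trace_eq_cons hx
    rw [wordProd_append_cons Γ t hs, wordProd_cons, ih]
    funext v
    have hv := congr_fun h v
    rw [trace_append_cons t hs, trace_cons, trace_cons] at hv
    exact List.append_cancel_left hv

/-! ### Reduced words and the action on their projections -/

/-- A word is reduced if no letter is trivial and no letter can be shuffled next to a later letter
at the same vertex. -/
def Reduced : List (Σ v, M v) → Prop
  | [] => True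
  | x :: l => x.2 ≠ 1 ∧ NoHead Γ x.1 l ∧ Reduced l

open Classical in
/-- Put an element of a vertex monoid in front of a word, unless it is trivial. -/
noncomputable def push (v : V) (b : M v) (l : List (Σ v, M v)) : List (Σ v, M v) :=
  if b = 1 then l else ⟨v, b⟩ :: l

variable {Γ}

@[simp] theorem push_one (v : V) (l : List (Σ v, M v)) : push v 1 l = l := by
  simp [push]

theorem push_of_ne_one {v : V} {b : M v} (hb : b ≠ 1) (l : List (Σ v, M v)) :
    push v b l = ⟨v, b⟩ :: l := by
  simp [push, hb]

@[simp] theorem wordProd_push (v : V) (b : M v) (l : List (Σ v, M v)) :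
    wordProd Γ (push v b l) = of Γ v b * wordProd Γ l := by
  by_cases hb : b = 1
  · simp [hb]
  · simp [push_of_ne_one hb]

theorem Reduced.push {v : V} {l : List (Σ v, M v)} (hl : Reduced Γ l) (hv : NoHead Γ v l)
    (b : M v) : Reduced Γ (push v b l) := by
  by_cases hb : b = 1
  · simpa [hb]
  · rw [push_of_ne_one hb]
    exact ⟨hb, hv, hl⟩

theorem trace_push_congr {v : V} (b : M v) {l l' : List (Σ v, M v)} (h : trace Γ l = trace Γ l') :
    trace Γ (push v b l) = trace Γ (push v b l') := by
  by_cases hb : b = 1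
  · simpa [hb]
  · funext w
    simp [push_of_ne_one hb, congr_fun h w]

theorem trace_push_of_adj {v w : V} (h : Γ.Adj v w) (b : M v) (l : List (Σ v, M v)) :
    trace Γ (push v b l) w = trace Γ l w := by
  by_cases hb : b = 1
  · simp [hb]
  · have : shadow Γ w (⟨v, b⟩ : Σ v, M v) = [] := shadow_of_adj h
    simp [push_of_ne_one hb, this]

theorem trace_push_comm {v w : V} (h : Γ.Adj v w) (b : M v) (c : M w) (l : List (Σ v, M v)) :
    trace Γ (push v b (push w c l)) = trace Γ (push w c (push v b l)) := by
  by_cases hb : b = 1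
  · simp [hb]
  by_cases hc : c = 1
  · simp [hc]
  funext z
  have := shadow_append_comm (Γ := Γ) (x := (⟨v, b⟩ : Σ v, M v)) (y := ⟨w, c⟩) h z
  simp only [push_of_ne_one hb, push_of_ne_one hc, trace_cons]
  rw [← List.append_assoc, this, List.append_assoc]

theorem trace_push_inj {v : V} {b b' : M v} {l l' : List (Σ v, M v)} (hl : NoHead Γ v l)
    (hl' : NoHead Γ v l') (h : trace Γ (push v b l) = trace Γ (push v b' l')) :
    b = b' ∧ trace Γ l = trace Γ l' := by
  have hs (a : M v) : shadow Γ v (⟨v, a⟩ : Σ v, M v) = [some ⟨v, a⟩] := shadow_self _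
  by_cases hb : b = 1 <;> by_cases hb' : b' = 1
  · subst hb hb'
    simpa using h
  · subst hb
    refine absurd ?_ (hl ⟨v, b'⟩)
    have := congr_fun h v
    rw [push_one] at this
    simp [this, push_of_ne_one hb', hs]
  · subst hb'
    refine absurd ?_ (hl' ⟨v, b⟩)
    have := congr_fun h v
    rw [push_one] at this
    simp [← this, push_of_ne_one hb, hs]
  · rw [push_of_ne_one hb, push_of_ne_one hb'] at h
    have hbb : b = b' := by
      have := congr_fun h v
      simp only [trace_cons, hs, List.cons_append, List.nil_append, List.cons.injEq,
        Option.some.injEq, Sigma.mk.injEq, true_and, heq_eq_eq] at this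
      exact this.1
    subst hbb
    exact ⟨rfl, funext fun w => List.append_cancel_left (congr_fun h w)⟩

/-- A letter that can be shuffled to the front can be deleted from a reduced word. -/
theorem Reduced.remove {x : Σ v, M v} {s t : List (Σ v, M v)} (hs : ∀ y ∈ s, Γ.Adj y.1 x.1)
    (h : Reduced Γ (s ++ x :: t)) : Reduced Γ (s ++ t) ∧ NoHead Γ x.1 (s ++ t) := by
  constructor
  · induction s with
    | nil => exact h.2.2
    | cons y s ih =>
      have hs' : ∀ z ∈ s, Γ.Adj z.1 x.1 := fun z hz => hs z (by simp [hz])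
      refine ⟨h.1, (noHead_congr ?_).1 h.2.1, ih hs' h.2.2⟩
      change trace Γ (s ++ x :: t) y.1 = trace Γ (s ++ t) y.1
      rw [trace_append_cons t hs', trace_cons, shadow_of_adj (hs y (by simp)).symm,
        List.nil_append]
  · have hx : NoHead Γ x.1 t := by
      clear hs
      induction s with
      | nil => exact h.2.1
      | cons y s ih => exact ih h.2.2
    refine (noHead_congr ?_).1 hx
    simp [trace_eq_nil_of_adj hs]

/-- Every reduced word can be split at the vertex `v` into an initial part in `M v` and a rest
that has no initial letter at `v`; by `trace_push_inj` the splitting is unique. -/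
theorem Reduced.exists_push {l : List (Σ v, M v)} (hl : Reduced Γ l) (v : V) :
    ∃ (b : M v) (l' : List (Σ v, M v)), Reduced Γ l' ∧ NoHead Γ v l' ∧
      trace Γ (GraphProduct.push v b l') = trace Γ l := by
  by_cases h : NoHead Γ v l
  · exact ⟨1, l, hl, h, by simp⟩
  · simp only [NoHead, not_forall, not_not] at h
    obtain ⟨x, hx⟩ := h
    obtain ⟨r, hr⟩ := List.head?_eq_some_iff.1 hx
    obtain ⟨rfl, s, t, rfl, hs⟩ := exists_eq_append_of_trace_eq_cons hr
    obtain ⟨h1, h2⟩ := hl.remove hs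
    have hx1 : x.2 ≠ 1 := by
      clear h1 h2 hx hr hs
      induction s with
      | nil => exact hl.1
      | cons y s ih => exact ih hl.2.2
    refine ⟨x.2, s ++ t, h1, h2, ?_⟩
    rw [push_of_ne_one hx1]
    exact funext fun v => (trace_append_cons t hs v).symm

theorem Reduced.of_append_left {l l' : List (Σ v, M v)} (h : Reduced Γ (l ++ l')) :
    Reduced Γ l := by
  induction l with
  | nil => trivial
  | cons x l ih => exact ⟨h.1, noHead_of_append h.2.1, ih h.2.2⟩

variable (Γ M) in
/-- Normal forms of elements of the graph product: the projections of reduced words. -/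
def NormalForm : Type (max u v) :=
  {σ : V → List (Option (Σ v, M v)) // ∃ l, Reduced Γ l ∧ trace Γ l = σ}

/-- The normal form given by a reduced word. -/
noncomputable def Reduced.toNormalForm {l : List (Σ v, M v)} (hl : Reduced Γ l) : NormalForm Γ M :=
  ⟨trace Γ l, l, hl, rfl⟩

theorem NormalForm.exists_push (v : V) (σ : NormalForm Γ M) :
    ∃ (b : M v) (l : List (Σ v, M v)) (hl : Reduced Γ l) (hv : NoHead Γ v l),
      (hl.push hv b).toNormalForm = σ := by
  obtain ⟨_, l, hl, rfl⟩ := σ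
  obtain ⟨b, l', hl', hv, h⟩ := hl.exists_push v
  exact ⟨b, l', hl', hv, Subtype.ext h⟩

/-- An element of `M v` acts on normal forms by multiplication of the initial part at `v`. The
splitting is chosen; `NormalForm.act_push` shows that any other splitting gives the same result. -/
noncomputable def NormalForm.act (v : V) (m : M v) (σ : NormalForm Γ M) : NormalForm Γ M :=
  ((σ.exists_push v).choose_spec.choose_spec.choose.push
    (σ.exists_push v).choose_spec.choose_spec.choose_spec.choose
    (m * (σ.exists_push v).choose)).toNormalForm

/-- The action does not depend on the chosen splitting. -/
theorem NormalForm.act_push {v : V} (m b : M v) {l : List (Σ v, M v)} (hl : Reduced Γ l)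
    (hv : NoHead Γ v l) :
    act v m (hl.push hv b).toNormalForm = (hl.push hv (m * b)).toNormalForm := by
  have h := (hl.push hv b).toNormalForm.exists_push v
  have hspec := h.choose_spec.choose_spec.choose_spec.choose_spec
  obtain ⟨h1, h2⟩ := trace_push_inj h.choose_spec.choose_spec.choose_spec.choose hv
    (congr_arg Subtype.val hspec)
  apply Subtype.ext
  exact (trace_push_congr (m * h.choose) h2).trans (by rw [h1]; rfl)

/-- For adjacent vertices a normal form splits at both at once, so that the actions commute. -/
theorem NormalForm.act_comm {v w : V} (h : Γ.Adj v w) (m : M v) (n : M w) (σ : NormalForm Γ M) :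
    act v m (act w n σ) = act w n (act v m σ) := by
  obtain ⟨b, l, hl, hv, rfl⟩ := σ.exists_push v
  obtain ⟨c, l', hl', hw, hc⟩ := hl.exists_push w
  have hv' : NoHead Γ v l' := by
    refine (noHead_congr ?_).1 hv
    rw [← hc, trace_push_of_adj h.symm]
  have hvc (c : M w) : NoHead Γ v (push w c l') :=
    (noHead_congr (trace_push_of_adj h.symm c l')).2 hv'
  have hwb (b : M v) : NoHead Γ w (push v b l') :=
    (noHead_congr (trace_push_of_adj h b l')).2 hw
  have hswap (b : M v) (c : M w) : ((hl'.push hv' b).push (hwb b) c).toNormalForm =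
      ((hl'.push hw c).push (hvc c) b).toNormalForm :=
    Subtype.ext (trace_push_comm h b c l').symm
  have hσ : (hl.push hv b).toNormalForm = ((hl'.push hw c).push (hvc c) b).toNormalForm :=
    Subtype.ext (trace_push_congr b hc.symm)
  rw [hσ, act_push m b (hl'.push hw c) (hvc c), ← hswap, ← hswap,
    act_push n c (hl'.push hv' b) (hwb b), act_push n c (hl'.push hv' (m * b)) (hwb (m * b)),
    hswap, hswap, act_push m b (hl'.push hw (n * c)) (hvc (n * c))]

variable (Γ) in
/-- The action of a vertex monoid on normal forms. -/
noncomputable def NormalForm.actHom (v : V) : M v →* Function.End (NormalForm Γ M) where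
  toFun m := (act v m : Function.End (NormalForm Γ M))
  map_one' := by
    funext σ
    obtain ⟨b, l, hl, hv, rfl⟩ := σ.exists_push v
    rw [act_push 1 b hl hv]
    simp only [one_mul]
    rfl
  map_mul' m n := by
    funext σ
    obtain ⟨b, l, hl, hv, rfl⟩ := σ.exists_push v
    change _ = act v m (act v n _)
    simp only [act_push _ _ hl hv, mul_assoc]

theorem NormalForm.actHom_comm {v w : V} (h : Γ.Adj v w) (m : M v) (n : M w) :
    actHom Γ v m * actHom Γ w n = actHom Γ w n * actHom Γ v m :=
  funext fun σ => act_comm h m n σ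

variable (Γ M) in
/-- The action of the graph product on normal forms. -/
noncomputable def NormalForm.action : GraphProduct Γ M →* Function.End (NormalForm Γ M) :=
  lift Γ (actHom Γ) actHom_comm

theorem NormalForm.action_of (v : V) (m : M v) (σ : NormalForm Γ M) :
    action Γ M (of Γ v m) σ = act v m σ :=
  congr_fun (a := σ) (lift_of Γ (actHom Γ) actHom_comm v m)

theorem NormalForm.action_mul (g h : GraphProduct Γ M) (σ : NormalForm Γ M) :
    action Γ M (g * h) σ = action Γ M g (action Γ M h σ) := by
  rw [map_mul]
  rfl

theorem induction_on {C : GraphProduct Γ M → Prop} (g : GraphProduct Γ M)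
    (one : C 1) (of : ∀ v (m : M v), C (of Γ v m)) (mul : ∀ x y, C x → C y → C (x * y)) : C g := by
  obtain ⟨g, rfl⟩ := Con.mk'_surjective (c := conGen (Rel Γ M)) g
  induction g using Monoid.CoprodI.induction_on with
  | one => exact one
  | of v m => exact of v m
  | mul x y hx hy =>
    have h := mul _ _ hx hy
    exact h

/-- The action on normal forms is compatible with left multiplication of products of words. In
particular every element is the product of a reduced word. -/
theorem NormalForm.action_toNormalForm (g : GraphProduct Γ M) {l : List (Σ v, M v)}
    (hl : Reduced Γ l) : ∃ (l' : List (Σ v, M v)) (hl' : Reduced Γ l'),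
      action Γ M g hl.toNormalForm = hl'.toNormalForm ∧ wordProd Γ l' = g * wordProd Γ l := by
  induction g using induction_on generalizing l with
  | one => exact ⟨l, hl, by rw [map_one]; rfl, by simp⟩
  | of v m =>
    obtain ⟨b, l', hl', hv, h⟩ := hl.exists_push v
    refine ⟨_, hl'.push hv (m * b), ?_, ?_⟩
    · rw [← act_push m b hl' hv, action_of]
      exact congr_arg _ (Subtype.ext h.symm)
    · rw [← wordProd_eq_of_trace_eq Γ h]
      simp [mul_assoc]
  | mul x y hx hy =>
    obtain ⟨l₁, hl₁, h₁, h₁'⟩ := hy hl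
    obtain ⟨l₂, hl₂, h₂, h₂'⟩ := hx hl₁
    refine ⟨l₂, hl₂, ?_, by rw [h₂', h₁', mul_assoc]⟩
    rw [action_mul, h₁, h₂]

theorem exists_reduced (g : GraphProduct Γ M) : ∃ l, Reduced Γ l ∧ wordProd Γ l = g := by
  obtain ⟨l, hl, -, h⟩ := NormalForm.action_toNormalForm g (l := []) trivial
  exact ⟨l, hl, by simpa using h⟩

theorem NormalForm.action_wordProd {l : List (Σ v, M v)} (hl : Reduced Γ l) :
    action Γ M (wordProd Γ l) (Reduced.toNormalForm (l := []) trivial) = hl.toNormalForm := by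
  induction l with
  | nil => rw [wordProd_nil, map_one]; rfl
  | cons x l ih =>
    rw [wordProd_cons, action_mul, ih hl.2.2, action_of]
    have h := act_push x.2 1 hl.2.2 hl.2.1
    simpa [push_of_ne_one hl.1] using h

/-- The normal form theorem: reduced words with the same product have the same projections. -/
theorem Reduced.trace_eq {l l' : List (Σ v, M v)} (hl : Reduced Γ l) (hl' : Reduced Γ l')
    (h : wordProd Γ l = wordProd Γ l') : trace Γ l = trace Γ l' := by
  have := NormalForm.action_wordProd hl
  rw [h, NormalForm.action_wordProd hl'] at this
  exact (congr_arg Subtype.val this).symm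

end Monoids

end GraphProduct

namespace GraphProduct

section Groups

/-! ### Submonoids of the vertex groups -/

variable {V : Type u} {Γ : SimpleGraph V} {G : V → Type v} [∀ v, Group (G v)]
  (P : ∀ v, Submonoid (G v))

/-- A letter with values in the submonoids, as a letter with values in the groups. -/
def letterIncl (x : Σ v, P v) : Σ v, G v := ⟨x.1, x.2⟩

theorem letterIncl_injective : Function.Injective (letterIncl P) := by
  rintro ⟨v, x⟩ ⟨w, y⟩ h
  simp only [letterIncl, Sigma.mk.injEq] at h
  obtain ⟨rfl, h⟩ := h
  rw [Subtype.ext (eq_of_heq h)]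

theorem trace_map_letterIncl (l : List (Σ v, P v)) (v : V) :
    trace Γ (l.map (letterIncl P)) v = (trace Γ l v).map (Option.map (letterIncl P)) := by
  induction l with
  | nil => rfl
  | cons x l ih =>
    have : shadow Γ v (letterIncl P x) = (shadow Γ v x).map (Option.map (letterIncl P)) := by
      by_cases hx : x.1 = v
      · simp [shadow, letterIncl, hx]
      · by_cases hadj : Γ.Adj x.1 v <;> simp [shadow, letterIncl, hx, hadj]
    rw [List.map_cons, trace_cons, trace_cons, ih, this, List.map_append]

theorem noHead_map_letterIncl {v : V} {l : List (Σ v, P v)} (h : NoHead Γ v l) :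
    NoHead Γ v (l.map (letterIncl P)) := by
  intro x hx
  rw [trace_map_letterIncl, List.head?_map, Option.map_eq_some_iff] at hx
  obtain ⟨y, hy, hyx⟩ := hx
  obtain ⟨z, rfl, -⟩ := Option.map_eq_some_iff.1 hyx
  exact h z hy

theorem Reduced.map_letterIncl {l : List (Σ v, P v)} (h : Reduced Γ l) :
    Reduced Γ (l.map (letterIncl P)) := by
  induction l with
  | nil => trivial
  | cons x l ih =>
    refine ⟨?_, noHead_map_letterIncl P h.2.1, ih h.2.2⟩
    exact fun hx => h.1 (Subtype.ext hx)

theorem wordProd_map_letterIncl (l : List (Σ v, P v)) :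
    wordProd Γ (l.map (letterIncl P)) = inclusion Γ P (wordProd Γ l) := by
  induction l with
  | nil => simp
  | cons x l ih =>
    rw [List.map_cons, wordProd_cons, wordProd_cons, ih, map_mul, inclusion_of]
    rfl

variable (Γ) in
theorem inclusion_injective : Function.Injective (inclusion Γ P) := by
  intro g h hgh
  obtain ⟨l, hl, rfl⟩ := exists_reduced g
  obtain ⟨l', hl', rfl⟩ := exists_reduced h
  rw [← wordProd_map_letterIncl, ← wordProd_map_letterIncl] at hgh
  have := (hl.map_letterIncl P).trace_eq (hl'.map_letterIncl P) hgh
  refine wordProd_eq_of_trace_eq Γ (funext fun v => ?_)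
  have hv := congr_fun this v
  rw [trace_map_letterIncl, trace_map_letterIncl] at hv
  exact List.map_injective_iff.2 (Option.map_injective (letterIncl_injective P)) hv

variable {P}

theorem of_mem_mrange {v : V} {a : G v} (ha : a ∈ P v) :
    of Γ v a ∈ MonoidHom.mrange (inclusion Γ P) :=
  ⟨of Γ v (⟨a, ha⟩ : P v), inclusion_of Γ P v _⟩

theorem wordProd_mem_mrange {l : List (Σ v, G v)} (h : ∀ x ∈ l, x.2 ∈ P x.1) :
    wordProd Γ l ∈ MonoidHom.mrange (inclusion Γ P) := by
  induction l with
  | nil => exact one_mem _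
  | cons x l ih =>
    rw [wordProd_cons]
    exact mul_mem (of_mem_mrange (h x (by simp))) (ih fun y hy => h y (by simp [hy]))

/-- The submonoid generated by the `P v` consists of the elements all of whose syllables lie in
the `P v`. -/
theorem Reduced.wordProd_mem_mrange_iff {l : List (Σ v, G v)} (hl : Reduced Γ l) :
    wordProd Γ l ∈ MonoidHom.mrange (inclusion Γ P) ↔ ∀ x ∈ l, x.2 ∈ P x.1 := by
  refine ⟨?_, wordProd_mem_mrange⟩
  rintro ⟨p, hp⟩ x hx
  obtain ⟨l', hl', rfl⟩ := exists_reduced p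
  rw [← wordProd_map_letterIncl] at hp
  have hx' := some_mem_trace (Γ := Γ) hx
  rw [← (hl'.map_letterIncl P).trace_eq hl hp] at hx'
  obtain ⟨y, -, rfl⟩ := List.mem_map.1 (mem_of_some_mem_trace hx')
  exact y.2.2

variable (Γ) in
/-- The elements of the graph product whose reduced words have no letter at `v` that can be
shuffled to the front. These represent the orbits of left multiplication by `G v`. -/
def Headless (v : V) (y : GraphProduct Γ G) : Prop :=
  ∃ l, Reduced Γ l ∧ NoHead Γ v l ∧ wordProd Γ l = y

theorem Headless.of_mul_inj {v : V} {a b : G v} {y z : GraphProduct Γ G} (hy : Headless Γ v y)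
    (hz : Headless Γ v z) (h : of Γ v a * y = of Γ v b * z) : a = b ∧ y = z := by
  obtain ⟨l, hl, hv, rfl⟩ := hy
  obtain ⟨l', hl', hv', rfl⟩ := hz
  rw [← wordProd_push, ← wordProd_push] at h
  obtain ⟨h1, h2⟩ := trace_push_inj hv hv' ((hl.push hv a).trace_eq (hl'.push hv' b) h)
  exact ⟨h1, wordProd_eq_of_trace_eq Γ h2⟩

theorem exists_headless (v : V) {q : GraphProduct Γ G}
    (hq : q ∈ MonoidHom.mrange (inclusion Γ P)) :
    ∃ a ∈ P v, ∃ y ∈ MonoidHom.mrange (inclusion Γ P), Headless Γ v y ∧ q = of Γ v a * y := by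
  obtain ⟨l, hl, rfl⟩ := exists_reduced q
  obtain ⟨b, l', hl', hv, h⟩ := hl.exists_push v
  have hprod := wordProd_eq_of_trace_eq Γ h
  rw [← hprod, (hl'.push hv b).wordProd_mem_mrange_iff] at hq
  rw [wordProd_push] at hprod
  by_cases hb : b = 1
  · refine ⟨b, hb ▸ one_mem _, _, wordProd_mem_mrange fun x hx => hq x ?_, ⟨l', hl', hv, rfl⟩,
      hprod.symm⟩
    simpa [hb] using hx
  · rw [push_of_ne_one hb] at hq
    exact ⟨b, hq ⟨v, b⟩ (by simp), _, wordProd_mem_mrange fun x hx => hq x (by simp [hx]),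
      ⟨l', hl', hv, rfl⟩, hprod.symm⟩

theorem Headless.of_mul {v w : V} (h : Γ.Adj w v) (b : G w) {y : GraphProduct Γ G}
    (hy : Headless Γ v y) : Headless Γ v (of Γ w b * y) := by
  obtain ⟨l, hl, hv, rfl⟩ := hy
  obtain ⟨c, l', hl', hw, hc⟩ := hl.exists_push w
  refine ⟨push w (b * c) l', hl'.push hw _, (noHead_congr ?_).1 hv, ?_⟩
  · rw [← hc, trace_push_of_adj h, trace_push_of_adj h]
  · rw [← wordProd_eq_of_trace_eq Γ hc]
    simp [mul_assoc]

theorem Headless.wordProd_mul {v : V} {t : List (Σ v, G v)} (ht : ∀ x ∈ t, Γ.Adj x.1 v)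
    {y : GraphProduct Γ G} (hy : Headless Γ v y) : Headless Γ v (wordProd Γ t * y) := by
  induction t with
  | nil => simpa
  | cons x t ih =>
    rw [wordProd_cons, mul_assoc]
    exact (ih fun z hz => ht z (by simp [hz])).of_mul (ht x (by simp)) _

theorem reduced_append_singleton {l : List (Σ v, G v)} {v : V} {a h : G v}
    (hl : Reduced Γ (l ++ [⟨v, a⟩])) (hh : h ≠ 1) : Reduced Γ (l ++ [⟨v, h⟩]) := by
  induction l with
  | nil => exact ⟨hh, by simp [NoHead], trivial⟩
  | cons x l ih =>
    refine ⟨hl.1, fun z hz => ?_, ih hl.2.2⟩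
    have h1 := hl.2.1
    change (trace Γ (l ++ [(⟨v, h⟩ : Σ v, G v)]) x.1).head? = _ at hz
    change NoHead Γ x.1 (l ++ [(⟨v, a⟩ : Σ v, G v)]) at h1
    by_cases hx : v = x.1
    · subst hx
      by_cases hnil : trace Γ l x.1 = []
      · apply h1 ⟨x.1, a⟩
        have : shadow Γ x.1 (⟨x.1, a⟩ : Σ v, G v) = [some ⟨x.1, a⟩] := shadow_self _
        simp [hnil, this]
      · exact (noHead_append_iff hnil).1 h1 z hz
    · refine h1 z ?_
      rw [← hz]
      simp [shadow, hx]

/-- The last letter `h` of a reduced word can be isolated: the word can be shuffled to `u h t`,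
where `t` commutes with `h` and all letters of `u` are blocked by letters to their right. Then
`u h` stays reduced whatever is appended to `h`. -/
theorem Reduced.exists_blocked {l : List (Σ v, G v)} {v : V} {h : G v}
    (hl : Reduced Γ (l ++ [⟨v, h⟩])) :
    ∃ u t : List (Σ v, G v), (∀ x ∈ t, Γ.Adj x.1 v) ∧
      trace Γ (u ++ ⟨v, h⟩ :: t) = trace Γ (l ++ [⟨v, h⟩]) ∧
      ∀ r, Reduced Γ r → NoHead Γ v r → Reduced Γ (u ++ ⟨v, h⟩ :: r) := by
  induction l with
  | nil => exact ⟨[], [], by simp, rfl, fun r hr hv => ⟨hl.1, hv, hr⟩⟩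
  | cons x l ih =>
    obtain ⟨u, t, ht, htr, hred⟩ := ih hl.2.2
    by_cases hx : trace Γ (u ++ [⟨v, h⟩]) x.1 = []
    · have hadj := adj_of_trace_eq_nil hx
      refine ⟨u, x :: t, ?_, ?_, hred⟩
      · simpa using ⟨(hadj ⟨v, h⟩ (by simp)).symm, ht⟩
      · funext w
        have := trace_append_cons t hadj w
        rw [List.append_assoc, List.append_assoc] at this
        exact this.trans (congr_arg (shadow Γ w x ++ ·) (congr_fun htr w))
    · refine ⟨x :: u, t, ht, ?_, fun r hr hv => ⟨hl.1, ?_, hred r hr hv⟩⟩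
      · funext w
        exact congr_arg (shadow Γ w x ++ ·) (congr_fun htr w)
      · have h1 : NoHead Γ x.1 (u ++ ⟨v, h⟩ :: t) := (noHead_congr (congr_fun htr x.1)).2 hl.2.1
        rw [List.append_cons] at h1
        change NoHead Γ x.1 (u ++ ⟨v, h⟩ :: r)
        rw [List.append_cons]
        exact (noHead_append_iff hx).1 h1

/-- If `x` and `g x` lie in the graph product of the `P v`, then so does `s x` for every final
syllable `s` of `g`. -/
theorem of_mul_mem_mrange {l : List (Σ v, G v)} {v : V} {a : G v}
    (hl : Reduced Γ (l ++ [⟨v, a⟩])) {q : GraphProduct Γ G}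
    (hq : q ∈ MonoidHom.mrange (inclusion Γ P))
    (hgq : wordProd Γ (l ++ [⟨v, a⟩]) * q ∈ MonoidHom.mrange (inclusion Γ P)) :
    of Γ v a * q ∈ MonoidHom.mrange (inclusion Γ P) := by
  obtain ⟨c, -, y, hy, hyv, rfl⟩ := exists_headless v hq
  rw [← mul_assoc, ← map_mul]
  suffices h : a * c ∈ P v from mul_mem (of_mem_mrange h) hy
  by_contra hac
  have hne : a * c ≠ 1 := fun h => hac (h ▸ one_mem _)
  -- The syllable `a c` cannot cancel in `g q`, so the latter has a syllable outside of `P v`.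
  obtain ⟨u, t, ht, htr, hred⟩ := (reduced_append_singleton hl hne).exists_blocked
  obtain ⟨r, hr, hrv, hrt⟩ := hyv.wordProd_mul ht
  have hprod : wordProd Γ (l ++ [⟨v, a⟩]) * (of Γ v c * y) =
      wordProd Γ (u ++ ⟨v, a * c⟩ :: r) := by
    have := wordProd_eq_of_trace_eq Γ htr
    simp only [wordProd_append, wordProd_cons, wordProd_nil, mul_one, map_mul, hrt] at this ⊢
    simp only [← mul_assoc] at this ⊢
    rw [this]
  rw [hprod, (hred r hr hrv).wordProd_mem_mrange_iff] at hgq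
  exact hac (hgq ⟨v, a * c⟩ (by simp))

/-! ### The left inverse hull -/

/-- Elements of the left inverse hull of `P v` extend to the graph product of the `P v`, by acting
on the initial parts at `v`. -/
theorem exists_extension {v : V} {s : P v ≃. P v} (hs : s ∈ LeftInverseHull (P v)) :
    ∃ S ∈ LeftInverseHull (MonoidHom.mrange (inclusion Γ P)),
      ∀ (a b : P v) (y z q r : MonoidHom.mrange (inclusion Γ P)),
        Headless Γ v (y : GraphProduct Γ G) → Headless Γ v (z : GraphProduct Γ G) →
        (q : GraphProduct Γ G) = of Γ v (a : G v) * y →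
        (r : GraphProduct Γ G) = of Γ v (b : G v) * z →
        (S q = some r ↔ s a = some b ∧ y = z) := by
  induction hs with
  | leftMul p =>
    refine ⟨_, LeftInverseHull.leftMul ⟨of Γ v (p : G v), of_mem_mrange p.2⟩, ?_⟩
    intro a b y z q r hy hz hq hr
    simp only [leftMulPEquiv, PEquiv.coe_mk, Option.some.injEq, Subtype.ext_iff,
      Submonoid.coe_mul, hq, hr]
    rw [← mul_assoc, ← map_mul]
    exact ⟨hy.of_mul_inj hz, fun h => by rw [h.1, h.2]⟩
  | symm _ ih =>
    obtain ⟨S, hS, h⟩ := ih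
    refine ⟨S.symm, hS.symm, fun a b y z q r hy hz hq hr => ?_⟩
    rw [PEquiv.eq_some_iff, PEquiv.eq_some_iff, h b a z y r q hz hy hr hq, eq_comm (a := y)]
  | comp _ _ ihs iht =>
    obtain ⟨S, hS, hs⟩ := ihs
    obtain ⟨T, hT, ht⟩ := iht
    refine ⟨T.trans S, hS.comp hT, fun a b y z q r hy hz hq hr => ?_⟩
    rw [PEquiv.trans_eq_some, PEquiv.trans_eq_some]
    constructor
    · rintro ⟨⟨m, hm⟩, h1, h2⟩
      obtain ⟨c, hc, x, hx, hxv, hmx⟩ := exists_headless v hm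
      obtain ⟨h1, rfl⟩ := (ht a ⟨c, hc⟩ y ⟨x, hx⟩ q ⟨m, hm⟩ hy hxv hq hmx).1 h1
      obtain ⟨h2, rfl⟩ := (hs ⟨c, hc⟩ b ⟨x, hx⟩ z ⟨m, hm⟩ r hxv hz hmx hr).1 h2
      exact ⟨⟨_, h1, h2⟩, rfl⟩
    · rintro ⟨⟨c, h1, h2⟩, rfl⟩
      exact ⟨⟨_, mul_mem (of_mem_mrange c.2) y.2⟩,
        (ht a c y y q _ hy hy hq rfl).2 ⟨h1, rfl⟩, (hs c b y y _ r hy hy rfl hr).2 ⟨h2, rfl⟩⟩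

end Groups

end GraphProduct

theorem Submonoid.translationPEquiv_eq_some_iff {G : Type u} [Group G] (P : Submonoid G) (g : G)
    (x y : P) : P.translationPEquiv g x = some y ↔ g * (x : G) = y := by
  simp only [translationPEquiv, PEquiv.coe_mk, Option.dite_none_right_eq_some, Option.some.injEq,
    Subtype.ext_iff]
  exact ⟨fun ⟨_, h⟩ => h, fun h => ⟨h ▸ y.2, h⟩⟩

theorem Submonoid.isToeplitz_iff {G : Type u} [Group G] (P : Submonoid G) :
    P.IsToeplitz ↔ ∀ g : G, ∀ x ∈ P, g * x ∈ P → P.translationPEquiv g ∈ LeftInverseHull P := by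
  refine forall_congr' fun g => ⟨fun h x hx hgx => h ⟨x, ?_, hx⟩, ?_⟩
  · rw [Set.mem_smul_set_iff_inv_smul_mem]
    simpa using hgx
  · rintro h ⟨x, hgx, hx⟩
    rw [Set.mem_smul_set_iff_inv_smul_mem] at hgx
    exact h x hx (by simpa using hgx)

/-! ### Translations by elements of the graph product -/

namespace GraphProduct

variable {V : Type u} {Γ : SimpleGraph V} {G : V → Type v} [∀ v, Group (G v)]
  {P : ∀ v, Submonoid (G v)}

/-- Translations by a single syllable. If the domain is nonempty, then so is the domain of the
corresponding translation of `P v`, to which the Toeplitz condition at `v` applies. -/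
theorem translationPEquiv_of_mem {v : V} (hP : (P v).IsToeplitz) {a : G v}
    {q : GraphProduct Γ G} (hq : q ∈ MonoidHom.mrange (inclusion Γ P))
    (haq : of Γ v a * q ∈ MonoidHom.mrange (inclusion Γ P)) :
    (MonoidHom.mrange (inclusion Γ P)).translationPEquiv (of Γ v a) ∈
      LeftInverseHull (MonoidHom.mrange (inclusion Γ P)) := by
  obtain ⟨c, hc, y, -, hyv, rfl⟩ := exists_headless v hq
  obtain ⟨d, hd, z, -, hzv, hz⟩ := exists_headless v haq
  rw [← mul_assoc, ← map_mul] at hz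
  obtain ⟨rfl, -⟩ := hyv.of_mul_inj hzv hz
  obtain ⟨S, hS, h⟩ := exists_extension (Γ := Γ) ((P v).isToeplitz_iff.1 hP a c hc hd)
  convert hS using 1
  refine PEquiv.ext fun x => Option.ext fun x' => ?_
  obtain ⟨e, he, y, hy, hyv, hx⟩ := exists_headless v x.2
  obtain ⟨f, hf, z, hz, hzv, hx'⟩ := exists_headless v x'.2
  rw [h ⟨e, he⟩ ⟨f, hf⟩ ⟨y, hy⟩ ⟨z, hz⟩ x x' hyv hzv hx hx',
    Submonoid.translationPEquiv_eq_some_iff, Submonoid.translationPEquiv_eq_some_iff, hx, hx',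
    ← mul_assoc, ← map_mul, Subtype.mk.injEq]
  exact ⟨hyv.of_mul_inj hzv, fun h => by rw [h.1, h.2]⟩

/-- The translation by a reduced word is the composite of the translations by its syllables. -/
theorem translationPEquiv_wordProd_mem (hP : ∀ v, (P v).IsToeplitz) {l : List (Σ v, G v)}
    (hl : Reduced Γ l) {q : GraphProduct Γ G} (hq : q ∈ MonoidHom.mrange (inclusion Γ P))
    (hlq : wordProd Γ l * q ∈ MonoidHom.mrange (inclusion Γ P)) :
    (MonoidHom.mrange (inclusion Γ P)).translationPEquiv (wordProd Γ l) ∈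
      LeftInverseHull (MonoidHom.mrange (inclusion Γ P)) := by
  induction l using List.reverseRecOn generalizing q with
  | nil =>
    suffices h : (MonoidHom.mrange (inclusion Γ P)).translationPEquiv (wordProd Γ []) =
        leftMulPEquiv 1 from h ▸ LeftInverseHull.leftMul 1
    refine PEquiv.ext fun x => Option.ext fun x' => ?_
    rw [Submonoid.translationPEquiv_eq_some_iff]
    simp only [leftMulPEquiv, PEquiv.coe_mk, Option.some.injEq, one_mul, wordProd_nil,
      Subtype.ext_iff]
  | append_singleton l x ih =>
    have hx := of_mul_mem_mrange hl hq hlq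
    have hmul : wordProd Γ (l ++ [x]) = wordProd Γ l * of Γ x.1 x.2 := by simp
    suffices h : (MonoidHom.mrange (inclusion Γ P)).translationPEquiv (wordProd Γ (l ++ [x])) =
        ((MonoidHom.mrange (inclusion Γ P)).translationPEquiv (of Γ x.1 x.2)).trans
          ((MonoidHom.mrange (inclusion Γ P)).translationPEquiv (wordProd Γ l)) from
      h ▸ (ih hl.of_append_left hx (by rwa [← mul_assoc, ← hmul])).comp
        (translationPEquiv_of_mem (hP x.1) hq hx)
    refine PEquiv.ext fun p => Option.ext fun r => ?_
    rw [Submonoid.translationPEquiv_eq_some_iff, PEquiv.trans_eq_some]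
    simp only [Submonoid.translationPEquiv_eq_some_iff]
    constructor
    · intro h
      -- Both sides have the same domain since the last syllable maps `p` into the submonoid.
      refine ⟨⟨_, of_mul_mem_mrange hl p.2 (h ▸ r.2)⟩, rfl, ?_⟩
      rw [← mul_assoc, ← hmul, h]
    · rintro ⟨m, h1, h2⟩
      rw [hmul, mul_assoc, h1, h2]

end GraphProduct

theorem mainTheorem8 {V : Type u} (Γ : SimpleGraph V) {G : V → Type v} [∀ v, Group (G v)]
    (P : ∀ v, Submonoid (G v)) (hP : ∀ v, (P v).IsToeplitz) :
    Function.Injective (GraphProduct.inclusion Γ P) ∧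
      (MonoidHom.mrange (GraphProduct.inclusion Γ P)).IsToeplitz := by
  refine ⟨GraphProduct.inclusion_injective Γ P, (Submonoid.isToeplitz_iff _).2 ?_⟩
  intro g q hq hgq
  obtain ⟨l, hl, rfl⟩ := GraphProduct.exists_reduced g
  exact GraphProduct.translationPEquiv_wordProd_mem hP hl hq hgq
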